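/- Let $d\in\{1,2\}$, $c>0$, let $B=B(0,1)\subset\mathbb R^d$ be the open unit ball, and let $\Omega\subset D\subset B$ be open sets. Let $q\in L^\infty(\mathbb R^d)$ be real-valued with $q=0$ a.e. outside $\Omega$ ($q$ need not be sign-definite). Let $q_{\inf}>0$ be a constant such that $\tilde q:=q_{\inf}1_D+q1_\Omega$ is a.e. bounded below on $D$ by a positive constant. All inner products are $L^2$ inner products, conjugate-linear in the second argument; those without subscript are in $L^2(B)$. For $g\in L^2(B)$ put $$u(x)=\int_B e^{2ic\,x\cdot y}q(y)\,dy,\qquad (\mathcal N g)(t)=\int_B u\Big(\frac{t-s}2\Big)g(s)\,ds,\qquad (\mathcal S g)(y)=\int_B e^{-ic\,s\cdot y}g(s)\,ds,$$ $$(\tilde{\mathcal N}g)(t)=\int_D (\mathcal S g)(y)\,q_{\inf}\,e^{ic\,t\cdot y}\,dy+(\mathcal N g)(t).$$ Let $R(z,\epsilon)\subset\mathbb R^d$ ($z\in\mathbb R^d$, $\epsilon>0$) be measurable sets with $R_{\inf}\epsilon^d\le|R(z,\epsilon)|\le R_{\sup}\epsilon^d$ for some positive constants $R_{\inf},R_{\sup}$,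 and put $E_z=|R(z,\epsilon)|^{-1}1_{R(z,\epsilon)}$ and $\phi_z(t)=\int_{\mathbb R^d}e^{ic\,t\cdot y}E_z(y)\,dy$. Let $f_\alpha:(0,\infty)\to\mathbb R$ ($\alpha>0$) be bounded functions (for instance piecewise continuous ones) such that $\lim_{\alpha\to0}f_\alpha(\mu)=1/\mu$ for all $\mu>0$ and $|\mu f_\alpha(\mu)|\le d_0$ for all $\alpha,\mu>0$, where $d_0>0$ is a constant. Then $\tilde{\mathcal N}$ has an eigensystem in $L^2(B)$: a complete orthonormal sequence $(\zeta_n)_{n\ge0}$ with $\tilde{\mathcal N}\zeta_n=\mu_n\zeta_n$ and $\mu_0\ge\mu_1\ge\cdots>0$. For every such eigensystem, with the regularized solutions $$\tilde g_{z,\alpha}=\sum_{n=0}^\infty f_\alpha(\mu_n^2)\,\mu_n\,\langle\phi_z,\zeta_n\rangle\,\zeta_n ,$$ and for every $z$ and $\epsilon>0$ with $\overline{R(z,\epsilon)}\subset D$, one has $$\lim_{\alpha\to0}\langle\mathcal S\tilde g_{z,\alpha},1_{R(z,\epsilon)}\rangle=\Big\langle\frac1{\tilde q},E_z\Big\rangle_{L^2(R(z,\epsilon))}=\Big\langle\frac{1/q_{\inf}}{1+q/q_{\inf}},E_z\Big\rangle_{L^2(R(z,\epsilon))}.$$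 -/

import Mathlib

open Filter Topology MeasureTheory Set

noncomputable section

namespace FourierLSM

/-- The Euclidean space `ℝ^d`. -/
abbrev Pt (d : ℕ) : Type := EuclideanSpace ℝ (Fin d)

/-- The open unit ball `B = B(0,1)` of `ℝ^d` (an interval for `d = 1`, a disk for `d = 2`). -/
def unitBall (d : ℕ) : Set (Pt d) := Metric.ball 0 1

/-- The complex Hilbert space `L²(B)`. -/
abbrev L2B (d : ℕ) : Type := Lp ℂ 2 ((volume : Measure (Pt d)).restrict (unitBall d))

/-- The plane wave `e^{i c t·y}`. -/
def planeWave {d : ℕ} (c : ℝ) (t y : Pt d) : ℂ :=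
  Complex.exp (Complex.I * ((c * inner ℝ t y : ℝ) : ℂ))

/-- The inner product of `L²(A)`, with conjugation in the second function. -/
def l2Inner {d : ℕ} (A : Set (Pt d)) (f g : Pt d → ℂ) : ℂ :=
  ∫ y in A, f y * (starRingEnd ℂ) (g y)

/-- The data `u(x) = ∫_B e^{i 2c x·y} q(y) dy`. -/
def dataFn {d : ℕ} (c : ℝ) (q : Pt d → ℝ) (x : Pt d) : ℂ :=
  ∫ y in unitBall d, planeWave (2 * c) x y * (q y : ℂ)

/-- The data operator `(N g)(t) = ∫_B u((t-s)/2) g(s) ds`. -/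
def dataOp {d : ℕ} (c : ℝ) (q : Pt d → ℝ) (g : Pt d → ℂ) (t : Pt d) : ℂ :=
  ∫ s in unitBall d, dataFn c q ((2⁻¹ : ℝ) • (t - s)) * g s

/-- The operator `(S g)(y) = ∫_B e^{-i c s·y} g(s) ds`. -/
def opS {d : ℕ} (c : ℝ) (g : Pt d → ℂ) (y : Pt d) : ℂ :=
  ∫ s in unitBall d, planeWave (-c) s y * g s

/-- The operator `(N_inf g)(t) = ∫_D [∫_B e^{-i c s·y} g(s) ds] q_inf e^{i c t·y} dy`. -/
def dataOpInf {d : ℕ} (c qinf : ℝ) (D : Set (Pt d)) (g : Pt d → ℂ) (t : Pt d) : ℂ :=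
  ∫ y in D, (opS c g y * (qinf : ℂ)) * planeWave c t y

/-- The modified data operator `N_inf + N`. -/
def dataOpTilde {d : ℕ} (c qinf : ℝ) (D : Set (Pt d)) (q : Pt d → ℝ)
    (g : Pt d → ℂ) (t : Pt d) : ℂ :=
  dataOpInf c qinf D g t + dataOp c q g t

/-- The modified parameter `q_inf 1_D + q 1_Ω`. -/
def qTilde {d : ℕ} (qinf : ℝ) (D Ω : Set (Pt d)) (q : Pt d → ℝ) (x : Pt d) : ℝ :=
  D.indicator (fun _ => qinf) x + Ω.indicator q x

/-- The indicator function `1_A`, complex valued. -/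
def charFn {d : ℕ} (A : Set (Pt d)) : Pt d → ℂ := A.indicator (fun _ => (1 : ℂ))

/-- The normalized indicator function `|A|⁻¹ 1_A`. -/
def avgFn {d : ℕ} (A : Set (Pt d)) (y : Pt d) : ℂ :=
  (((volume : Measure (Pt d)).real A)⁻¹ : ℂ) * charFn A y

/-- The test function `t ↦ ∫_{ℝ^d} e^{i c t·y} |A|⁻¹ 1_A(y) dy`. -/
def phiFn {d : ℕ} (c : ℝ) (A : Set (Pt d)) (t : Pt d) : ℂ :=
  ∫ y, planeWave c t y * avgFn A y

/-- `(ζ n, μ n)` is an eigensystem in `L²(B)` of the operator `T`: the `ζ n` form a complete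
orthonormal system of eigenfunctions and `μ 0 ≥ μ 1 ≥ ⋯ > 0` are the eigenvalues
(equality in `L²(B)` is equality almost everywhere in `B`). -/
def IsEigensystem {d : ℕ} (T : (Pt d → ℂ) → (Pt d → ℂ))
    (ζ : HilbertBasis ℕ ℂ (L2B d)) (μ : ℕ → ℝ) : Prop :=
  Antitone μ ∧ (∀ n, 0 < μ n) ∧
    ∀ n, T (ζ n) =ᵐ[(volume : Measure (Pt d)).restrict (unitBall d)]
      fun t => (μ n : ℂ) * (ζ n : Pt d → ℂ) t

/-- `f α : (0,∞) → ℝ`, `α > 0`, is a family of regularizing filters with constant `d₀`: each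
`f α` is bounded, `f α m → 1/m` as `α → 0+`, and `|m f α m| ≤ d₀`. No continuity of `f α` is
required, so piecewise continuous filters are included. -/
structure IsRegularizingFilter (f : ℝ → ℝ → ℝ) (d₀ : ℝ) : Prop where
  pos : 0 < d₀
  bounded : ∀ α, 0 < α → ∃ C, ∀ m, 0 < m → |f α m| ≤ C
  tendsto : ∀ m, 0 < m → Tendsto (fun α => f α m) (𝓝[>] 0) (𝓝 (1 / m))
  bound : ∀ α, 0 < α → ∀ m, 0 < m → |m * f α m| ≤ d₀

/-- The regularized solution `R_α φ = ∑ f_α(μ_n²) μ_n ⟨φ, ζ_n⟩ ζ_n`, a series in `L²(B)`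
(it converges for every `φ ∈ L²(B)` because `f_α` and `μ` are bounded). -/
def regSolution {d : ℕ} (ζ : HilbertBasis ℕ ℂ (L2B d)) (μ : ℕ → ℝ) (f : ℝ → ℝ → ℝ)
    (α : ℝ) (φ : Pt d → ℂ) : L2B d :=
  ∑' n, (((f α (μ n ^ 2) * μ n : ℝ) : ℂ) * l2Inner (unitBall d) φ (ζ n)) • ζ n

end FourierLSM

end

/-! Let `S^*` be the Fourier integral `h ↦ ∫ e^{ic t·y} h(y) dy` viewed in `L²(B)` (`waveL2`). Since
`e^{2ic ((t-s)/2)·y} = e^{ic t·y} e^{-ic s·y}`, the modified data operator is `S^* q̃ S`; likewise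
`φ_z = S^* E_z`. Along each real line `S g` extends to an entire function, so it cannot vanish on
the nonempty open set `D` unless `g = 0`. As `q̃ ≥ m > 0` on `D`, the operator is compact, symmetric
and strictly positive, and the spectral theorem gives an eigensystem.

For any eigensystem, the functions `χ_n = √q̃ S ζ_n` are orthogonal in `L²(D)` with `‖χ_n‖² = μ_n`,
and total there because `S^*` is injective on functions supported in `D`. Since `⟨φ_z, ζ_n⟩ =
⟨E_z/√q̃, χ_n⟩`, Parseval gives the Picard sum `∑ |⟨φ_z, ζ_n⟩|²/μ_n = ∫_D |E_z|²/q̃`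
(`IsWeight.hasSum_norm_inner_sq_div`).

By adjointness `⟨S g, 1_R⟩ = |R| ⟨g, φ_z⟩`, so the tested regularized solution equals `|R| ∑ μ_n²
f_α(μ_n²) |⟨φ_z, ζ_n⟩|²/μ_n`. The filter factors tend to 1 and are bounded by `d₀`; dominated
convergence (`tendsto_inner_filtered_expansion`) gives the limit `|R| ∫_D |E_z|²/q̃`, which is `∫_R
E_z/q̃` because `|R| E_z = 1` on `R`. -/

namespace FourierLSM

/-! ### Spectral theorem with ordered eigenvalues -/

/-- A positive family all of whose superlevel sets are finite can be listed in decreasing order. -/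
theorem exists_equiv_nat_antitone {ι : Type*} [Infinite ι] (l : ι → ℝ) (hl : ∀ i, 0 < l i)
    (hfin : ∀ ε > 0, {i | ε ≤ l i}.Finite) : ∃ e : ℕ ≃ ι, Antitone (l ∘ e) := by
  classical
  have hcount : Countable ι := by
    rw [← Set.countable_univ_iff]
    have : (Set.univ : Set ι) ⊆ ⋃ n : ℕ, {i | 1 / ((n : ℝ) + 1) ≤ l i} := by
      intro i _
      obtain ⟨n, hn⟩ := exists_nat_one_div_lt (hl i)
      exact Set.mem_iUnion.2 ⟨n, hn.le⟩
    exact (Set.countable_iUnion fun n => (hfin _ (by positivity)).countable).mono this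
  obtain ⟨j, hj⟩ := hcount.exists_injective_nat
  -- Larger values come first; the injection `j` breaks ties, so this is a linear order. Its initial
  -- segments lie in superlevel sets, hence are finite, which forces order type `ℕ`.
  let key : ι → ℝᵒᵈ ×ₗ ℕ := fun i => toLex (OrderDual.toDual (l i), j i)
  have hkey : Function.Injective key := by
    intro a b h
    have h' := congrArg ofLex h
    exact hj (congrArg Prod.snd h')
  let : LinearOrder ι := LinearOrder.lift' key hkey
  have hle : ∀ {a b : ι}, a ≤ b → l b ≤ l a := by
    intro a b h
    have h' : key a ≤ key b := h
    rw [Prod.Lex.le_iff] at h'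
    rcases h' with h' | ⟨h', -⟩
    · exact le_of_lt h'
    · exact le_of_eq (congrArg OrderDual.ofDual h').symm
  have hIic : ∀ b : ι, (Set.Iic b).Finite := fun b => (hfin (l b) (hl b)).subset fun a ha => hle ha
  let : LocallyFiniteOrder ι :=
    LocallyFiniteOrder.ofFiniteIcc fun a b => (hIic b).subset fun x hx => hx.2
  have : NoMaxOrder ι := by
    refine ⟨fun a => ?_⟩
    by_contra! h
    exact Set.infinite_univ ((hIic a).subset fun x _ => h x)
  obtain ⟨i₀⟩ : Nonempty ι := inferInstance
  obtain ⟨b, hb⟩ : ∃ b : ι, ∀ a, b ≤ a := by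
    obtain ⟨b, hb, hmin⟩ := Set.exists_min_image (Set.Iic i₀) id (hIic i₀)
      ⟨i₀, Set.mem_Iic.2 le_rfl⟩
    refine ⟨b, fun a => ?_⟩
    rcases le_total a i₀ with h | h
    · exact hmin a h
    · exact le_trans hb h
  let : OrderBot ι := { bot := b, bot_le := hb }
  let : SuccOrder ι := LinearLocallyFiniteOrder.succOrder ι
  let : PredOrder ι := LinearLocallyFiniteOrder.predOrder ι
  let e : ι ≃o ℕ := orderIsoNatOfLinearSuccPredArch
  exact ⟨e.symm.toEquiv, fun m n h => hle (e.symm.monotone h)⟩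

variable {H : Type*} [NormedAddCommGroup H] [InnerProductSpace ℂ H]

/-- A compact operator has only finitely many eigenvalues of modulus `≥ ε` along an orthonormal
family of eigenvectors. -/
theorem finite_setOf_le_of_isCompactOperator {ι : Type*} {T : H →L[ℂ] H} (hT : IsCompactOperator T)
    {b : ι → H} (hb : Orthonormal ℂ b) {l : ι → ℝ} (hTb : ∀ i, T (b i) = (l i : ℂ) • b i)
    {ε : ℝ} (hε : 0 < ε) : {i | ε ≤ l i}.Finite := by
  by_contra hinf
  have hinf : {i | ε ≤ l i}.Infinite := hinf
  let s := hinf.natEmbedding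
  -- Infinitely many such eigenvectors would have images with a Cauchy subsequence, but by
  -- Pythagoras these images stay at distance at least `ε`.
  obtain ⟨K, hK, hTK⟩ := hT.image_closedBall_subset_compact (f := T.toLinearMap) 1
  have hmem : ∀ n, T (b (s n)) ∈ K := fun n =>
    hTK ⟨b (s n), by simp [hb.1], rfl⟩
  obtain ⟨x, -, φ, hφ, hx⟩ := hK.tendsto_subseq hmem
  have hc := hx.cauchySeq
  rw [Metric.cauchySeq_iff'] at hc
  obtain ⟨N, hN⟩ := hc ε hε
  have h1 := hN (N + 1) (Nat.le_succ N)
  set i : ι := (s (φ (N + 1)) : ι) with hi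
  set j : ι := (s (φ N) : ι) with hj
  have hij : i ≠ j := by
    intro h
    have := s.injective (Subtype.ext h)
    exact absurd (hφ.injective this) (by simp)
  have h2 : ‖T (b i) - T (b j)‖ ^ 2 = l i ^ 2 + l j ^ 2 := by
    rw [hTb, hTb, sq, sq, sq]
    rw [@norm_sub_mul_self ℂ]
    simp only [inner_smul_left, inner_smul_right, hb.2 hij, norm_smul, hb.1]
    simp
  have h3 : ε ≤ l i := (s (φ (N + 1))).2
  have h4 : dist (T (b i)) (T (b j)) < ε := h1
  rw [dist_eq_norm] at h4
  nlinarith [norm_nonneg (T (b i) - T (b j)), sq_nonneg (l j)]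

variable [CompleteSpace H]

/-- **Spectral theorem** for an injective positive compact operator on an infinite-dimensional
Hilbert space, with the eigenvalues listed in decreasing order. -/
theorem exists_hilbertBasis_antitone_eigenvalues (hH : ¬ FiniteDimensional ℂ H) {T : H →L[ℂ] H}
    (hT : IsCompactOperator T) (hsymm : T.IsSymmetric)
    (hpos : ∀ x, x ≠ 0 → 0 < (inner ℂ x (T x)).re) :
    ∃ (b : HilbertBasis ℕ ℂ H) (μ : ℕ → ℝ), Antitone μ ∧ (∀ n, 0 < μ n) ∧
      ∀ n, T (b n) = (μ n : ℂ) • b n := by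
  -- Positivity excludes the eigenvalue 0, the only one whose eigenspace compactness would allow to
  -- be infinite-dimensional.
  have hne : ∀ μ : ℂ, (Module.End.eigenspace (T : Module.End ℂ H) μ) ≠ ⊥ → 0 < μ.re ∧ μ.im = 0 := by
    intro μ hμ
    obtain ⟨x, hx, hx0⟩ := Submodule.exists_mem_ne_zero_of_ne_bot hμ
    have hx' : T x = μ • x := Module.End.mem_eigenspace_iff.1 hx
    have h1 := hpos x hx0
    have h2 := hsymm.conj_eigenvalue_eq_self
      (Module.End.hasEigenvalue_of_hasEigenvector ⟨hx, hx0⟩)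
    refine ⟨?_, Complex.conj_eq_iff_im.1 h2⟩
    rw [hx', inner_smul_right, inner_self_eq_norm_sq_to_K] at h1
    have h3 : (μ * ((‖x‖ : ℂ)) ^ 2).re = μ.re * ‖x‖ ^ 2 := by
      rw [← Complex.ofReal_pow, Complex.re_mul_ofReal]
    erw [h3] at h1
    exact pos_of_mul_pos_left h1 (by positivity)
  have hfd : ∀ μ : ℂ, FiniteDimensional ℂ (Module.End.eigenspace (T : Module.End ℂ H) μ) := by
    intro μ
    by_cases h : Module.End.eigenspace (T : Module.End ℂ H) μ = ⊥
    · rw [h]; infer_instance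
    · refine ContinuousLinearMap.finite_dimensional_eigenspace hT μ ?_
      rintro rfl
      simpa using (hne 0 h).1
  let ι := Σ μ : ℂ, Fin (Module.finrank ℂ (Module.End.eigenspace (T : Module.End ℂ H) μ))
  let v : ι → H := fun a => (stdOrthonormalBasis ℂ
    (Module.End.eigenspace (T : Module.End ℂ H) a.1) a.2 : H)
  have hv : Orthonormal ℂ v :=
    hsymm.orthogonalFamily_eigenspaces.orthonormal_sigma_orthonormal
      (v_family := fun μ => stdOrthonormalBasis ℂ (Module.End.eigenspace (T : Module.End ℂ H) μ))
      fun μ => (stdOrthonormalBasis ℂ _).orthonormal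
  have hmem : ∀ a : ι, v a ∈ Module.End.eigenspace (T : Module.End ℂ H) a.1 := fun a => by
    exact Subtype.property _
  have hTv : ∀ a : ι, T (v a) = a.1 • v a := fun a => Module.End.mem_eigenspace_iff.1 (hmem a)
  have hpos' : ∀ a : ι, 0 < a.1.re ∧ a.1.im = 0 := by
    intro a
    refine hne a.1 fun h => ?_
    have h1 := hmem a
    rw [h, Submodule.mem_bot] at h1
    exact hv.ne_zero a h1
  have hTv' : ∀ a : ι, T (v a) = (a.1.re : ℂ) • v a := by
    intro a
    rw [hTv a]
    congr 1
    apply Complex.ext <;> simp [(hpos' a).2]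
  have hspan : (Submodule.span ℂ (Set.range v))ᗮ = ⊥ := by
    rw [eq_bot_iff, ← ContinuousLinearMap.orthogonalComplement_iSup_eigenspaces_eq_bot hT hsymm]
    apply Submodule.orthogonal_le
    refine iSup_le fun μ x hx => ?_
    have h1 := (stdOrthonormalBasis ℂ (Module.End.eigenspace (T : Module.End ℂ H) μ)).sum_repr
      ⟨x, hx⟩
    have h2 := congrArg Subtype.val h1
    simp only [AddSubmonoidClass.coe_finsetSum, Submodule.coe_smul] at h2
    rw [← h2]
    exact Submodule.sum_mem _ fun i _ => Submodule.smul_mem _ _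
      (Submodule.subset_span ⟨⟨μ, i⟩, rfl⟩)
  let b := HilbertBasis.mkOfOrthogonalEqBot hv hspan
  have hb : ∀ a, b a = v a := fun a => by simp [b]
  have : Infinite ι := by
    by_contra hfin
    rw [not_infinite_iff_finite] at hfin
    have := Fintype.ofFinite ι
    exact hH (Module.Basis.finiteDimensional_of_finite b.toOrthonormalBasis.toBasis)
  obtain ⟨e, he⟩ := exists_equiv_nat_antitone (fun a : ι => a.1.re) (fun a => (hpos' a).1)
    fun ε hε => finite_setOf_le_of_isCompactOperator hT hv hTv' hε
  have hsp : (Submodule.span ℂ (Set.range (v ∘ e)))ᗮ = ⊥ := by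
    rw [e.surjective.range_comp]; exact hspan
  refine ⟨HilbertBasis.mkOfOrthogonalEqBot (hv.comp e e.injective) hsp, fun n => (e n).1.re, he,
    fun n => (hpos' _).1, fun n => ?_⟩
  simp only [HilbertBasis.coe_mkOfOrthogonalEqBot, Function.comp]
  exact hTv' (e n)

/-! ### Expansions and compact operators in Hilbert space -/

/-- Picard-type limit of filtered eigenfunction expansions. -/
theorem tendsto_inner_filtered_expansion (ζ : HilbertBasis ℕ ℂ H) {μ : ℕ → ℝ} (hμ : Antitone μ)
    (hμpos : ∀ n, 0 < μ n) {f : ℝ → ℝ → ℝ} {d₀ : ℝ} (hf : IsRegularizingFilter f d₀) (x : H)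
    {S : ℝ} (hS : HasSum (fun n => ‖inner ℂ (ζ n) x‖ ^ 2 / μ n) S) :
    Tendsto (fun α : ℝ => inner ℂ x
      (∑' n, (((f α (μ n ^ 2) * μ n : ℝ) : ℂ) * inner ℂ (ζ n) x) • ζ n)) (𝓝[>] 0) (𝓝 (S : ℂ)) := by
  have hparseval : Summable fun n => ‖inner ℂ (ζ n) x‖ ^ 2 := by
    simpa [HilbertBasis.repr_apply_apply] using (lp.memℓp (ζ.repr x)).summable (by norm_num)
  have hterm : ∀ α > 0, inner ℂ x
      (∑' n, (((f α (μ n ^ 2) * μ n : ℝ) : ℂ) * inner ℂ (ζ n) x) • ζ n) =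
      ∑' n, ((μ n ^ 2 * f α (μ n ^ 2) * (‖inner ℂ (ζ n) x‖ ^ 2 / μ n) : ℝ) : ℂ) := by
    intro α hα
    obtain ⟨C, hC⟩ := hf.bounded α hα
    -- For fixed `α` the multipliers are bounded by `C * μ 0`, so the coefficients remain square
    -- summable.
    have hsum : Summable fun n => (((f α (μ n ^ 2) * μ n : ℝ) : ℂ) * inner ℂ (ζ n) x) • ζ n := by
      have := (ζ.orthonormal.orthogonalFamily.summable_iff_norm_sq_summable
        (fun n => ((f α (μ n ^ 2) * μ n : ℝ) : ℂ) * inner ℂ (ζ n) x)).2 (by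
          refine Summable.of_nonneg_of_le (fun n => by positivity) (fun n => ?_)
            (hparseval.mul_left ((C * μ 0) ^ 2))
          rw [norm_mul, mul_pow, Complex.norm_real, Real.norm_eq_abs, abs_mul,
            abs_of_pos (hμpos n)]
          have h1 := hC (μ n ^ 2) (by have := hμpos n; positivity)
          have h2 : μ n ≤ μ 0 := hμ (Nat.zero_le n)
          have h3 := (hμpos n).le
          gcongr
          exact (abs_nonneg _).trans h1)
      simpa using! this
    rw [← innerSL_apply_apply ℂ, ContinuousLinearMap.map_tsum _ hsum]
    refine tsum_congr fun n => ?_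
    have h3 := (hμpos n).ne'
    rw [innerSL_apply_apply, inner_smul_right, mul_assoc, ← inner_conj_symm x, Complex.mul_conj,
      Complex.normSq_eq_norm_sq, ← Complex.ofReal_mul]
    congr 1
    field_simp
  rw [← hS.tsum_eq, Complex.ofReal_tsum]
  refine Tendsto.congr' (f₁ := fun α => ∑' n, ((μ n ^ 2 * f α (μ n ^ 2) *
    (‖inner ℂ (ζ n) x‖ ^ 2 / μ n) : ℝ) : ℂ)) ?_ ?_
  · filter_upwards [self_mem_nhdsWithin] with α hα using (hterm α hα).symm
  · refine tendsto_tsum_of_dominated_convergence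
      (bound := fun n => d₀ * (‖inner ℂ (ζ n) x‖ ^ 2 / μ n)) (hS.summable.mul_left d₀) ?_ ?_
    · intro n
      have h3 : 0 < μ n ^ 2 := by have := hμpos n; positivity
      have h4 := (hf.tendsto (μ n ^ 2) h3).const_mul (μ n ^ 2)
      rw [mul_one_div_cancel h3.ne'] at h4
      have h5 := h4.mul_const (‖inner ℂ (ζ n) x‖ ^ 2 / μ n)
      rw [one_mul] at h5
      exact (Complex.continuous_ofReal.tendsto _).comp h5
    · filter_upwards [self_mem_nhdsWithin] with α hα n
      have h3 := hμpos n
      rw [Complex.norm_real, Real.norm_eq_abs, abs_mul, abs_of_nonneg (a := _ / _) (by positivity)]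
      exact mul_le_mul_of_nonneg_right (hf.bound α hα _ (by positivity)) (by positivity)

/-- Parseval's identity for a total orthogonal family. -/
theorem hasSum_norm_inner_sq_div_of_orthogonal {ι : Type*} [DecidableEq ι] {χ : ι → H} {μ : ι → ℝ}
    (hμ : ∀ n, 0 < μ n) (hχ : ∀ m n, inner ℂ (χ m) (χ n) = if m = n then (μ n : ℂ) else 0)
    (htotal : ∀ v, (∀ n, inner ℂ (χ n) v = 0) → v = 0) (v : H) :
    HasSum (fun n => ‖inner ℂ (χ n) v‖ ^ 2 / μ n) (‖v‖ ^ 2) := by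
  let ψ : ι → H := fun n => (((√(μ n))⁻¹ : ℝ) : ℂ) • χ n
  have hs : ∀ n, 0 < √(μ n) := fun n => Real.sqrt_pos.2 (hμ n)
  have hψ : Orthonormal ℂ ψ := by
    rw [orthonormal_iff_ite]
    intro m n
    simp only [ψ, inner_smul_left, inner_smul_right, hχ, Complex.conj_ofReal]
    split_ifs with h
    · subst h
      have h1 : (√(μ m))⁻¹ * ((√(μ m))⁻¹ * μ m) = 1 := by
        have := hs m
        nth_rewrite 3 [← Real.mul_self_sqrt (hμ m).le]
        field_simp
      exact_mod_cast h1
    · simp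
  have hin : ∀ n w, inner ℂ (ψ n) w = (((√(μ n))⁻¹ : ℝ) : ℂ) * inner ℂ (χ n) w := fun n w => by
    simp only [ψ, inner_smul_left, Complex.conj_ofReal]
  have hsp : (Submodule.span ℂ (Set.range ψ))ᗮ = ⊥ := by
    rw [Submodule.eq_bot_iff]
    intro w hw
    refine htotal w fun n => ?_
    have h1 := (Submodule.mem_orthogonal _ _).1 hw (ψ n) (Submodule.subset_span ⟨n, rfl⟩)
    rw [hin] at h1
    exact (mul_eq_zero.1 h1).resolve_left (by simpa using (hs n).ne')
  let b := HilbertBasis.mkOfOrthogonalEqBot hψ hsp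
  have h1 := b.hasSum_inner_mul_inner v v
  rw [inner_self_eq_norm_sq_to_K] at h1
  have h2 : ∀ n, inner ℂ v (b n) * inner ℂ (b n) v = ((‖inner ℂ (χ n) v‖ ^ 2 / μ n : ℝ) : ℂ) := by
    intro n
    have hb : b n = ψ n := by simp [b]
    rw [hb, ← inner_conj_symm v, mul_comm, Complex.mul_conj, Complex.normSq_eq_norm_sq, hin,
      norm_mul, mul_pow, Complex.norm_real, Real.norm_eq_abs, sq_abs, inv_pow,
      Real.sq_sqrt (hμ n).le, div_eq_inv_mul]
  simp only [h2] at h1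
  have h3 : ((RCLike.ofReal ‖v‖ : ℂ)) ^ 2 = ((‖v‖ ^ 2 : ℝ) : ℂ) := by push_cast; rfl
  rw [h3] at h1
  exact Complex.hasSum_ofReal.1 h1

/-- A weighted integral of rank one projections is a compact operator. -/
theorem exists_isCompactOperator_inner_eq_integral {X : Type*} [TopologicalSpace X]
    [MeasurableSpace X] [OpensMeasurableSpace X] [SecondCountableTopology X]
    {ν : Measure X} {k : X → H} (hk : Continuous k) {K : ℝ}
    (hK : ∀ y, ‖k y‖ ≤ K) {Q : X → ℂ} (hQ : Integrable Q ν) :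
    ∃ T : H →L[ℂ] H, IsCompactOperator T ∧
      ∀ g h, inner ℂ h (T g) = ∫ y, Q y * inner ℂ (k y) g * inner ℂ h (k y) ∂ν := by
  -- Compact operators form a closed, hence complete, subspace; integrating inside it makes
  -- compactness of the result automatic.
  let S : Submodule ℂ (H →L[ℂ] H) := compactOperator (RingHom.id ℂ) H H
  have hS : IsClosed (S : Set (H →L[ℂ] H)) := isClosed_setOfPred_isCompactOperator
  have : CompleteSpace S := hS.completeSpace_coe
  let r : X → S := fun y => ⟨InnerProductSpace.rankOne ℂ (k y) (k y),
    (isCompactOperator_of_locallyCompactSpace_rng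
      (ContinuousLinearMap.toSpanSingleton ℂ (k y))).comp_clm (innerSL ℂ (k y))⟩
  have hrc : Continuous r := by
    refine Continuous.subtype_mk ?_ _
    exact ((ContinuousLinearMap.smulRightL ℂ H H).continuous.comp
      ((innerSL ℂ).continuous.comp hk)).clm_apply hk
  have : SecondCountableTopologyEither X S := secondCountableTopologyEither_of_left X S
  have hri : Integrable (fun y => Q y • r y) ν := by
    refine hQ.smul_bdd (K * K) hrc.aestronglyMeasurable (Eventually.of_forall fun y => ?_)
    change ‖InnerProductSpace.rankOne ℂ (k y) (k y)‖ ≤ K * K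
    rw [InnerProductSpace.norm_rankOne]
    exact mul_self_le_mul_self (norm_nonneg _) (hK y)
  refine ⟨(∫ y, Q y • r y ∂ν : S), (∫ y, Q y • r y ∂ν : S).2, fun g h => ?_⟩
  let ℓ : S →L[ℂ] ℂ := (innerSL ℂ h) ∘L (ContinuousLinearMap.apply ℂ H g) ∘L S.subtypeL
  have h1 : inner ℂ h (((∫ y, Q y • r y ∂ν : S) : H →L[ℂ] H) g) = ℓ (∫ y, Q y • r y ∂ν) := rfl
  rw [h1, ← ContinuousLinearMap.integral_comp_comm ℓ hri]
  refine integral_congr_ae (Eventually.of_forall fun y => ?_)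
  have h2 : ℓ (r y) = inner ℂ h (inner ℂ (k y) g • k y) := rfl
  simp only [map_smul, h2, inner_smul_right, smul_eq_mul]
  ring

end FourierLSM

/-! ### Fourier integrals: injectivity and identity theorem -/

namespace FourierLSM

variable {d : ℕ}

theorem continuous_planeWave (c : ℝ) : Continuous fun p : Pt d × Pt d => planeWave c p.1 p.2 := by
  unfold planeWave
  fun_prop

theorem norm_planeWave (c : ℝ) (t y : Pt d) : ‖planeWave c t y‖ = 1 := by
  rw [planeWave, mul_comm, Complex.norm_exp_ofReal_mul_I]

theorem planeWave_comm (c : ℝ) (t y : Pt d) : planeWave c t y = planeWave c y t := by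
  rw [planeWave, planeWave, real_inner_comm]

theorem conj_planeWave (c : ℝ) (t y : Pt d) :
    (starRingEnd ℂ) (planeWave c t y) = planeWave (-c) t y := by
  simp [planeWave, ← Complex.exp_conj]

theorem norm_planeWave_sub_le (c : ℝ) (t y y' : Pt d) :
    ‖planeWave c t y - planeWave c t y'‖ ≤ |c| * ‖t‖ * ‖y - y'‖ := by
  have h : planeWave c t y - planeWave c t y' =
      planeWave c t y' * (Complex.exp (Complex.I * ((c * inner ℝ t (y - y') : ℝ) : ℂ)) - 1) := by
    rw [planeWave, planeWave, mul_sub, mul_one, ← Complex.exp_add, inner_sub_right]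
    congr 2
    push_cast
    ring
  rw [h, norm_mul, norm_planeWave, one_mul]
  refine (Real.norm_exp_I_mul_ofReal_sub_one_le).trans ?_
  rw [Real.norm_eq_abs, abs_mul, mul_assoc]
  exact mul_le_mul_of_nonneg_left (abs_real_inner_le_norm _ _) (abs_nonneg _)

/-- The (rescaled) Fourier integral `t ↦ ∫ e^{i c t·y} h(y) dy`. -/
noncomputable def waveIntegral (c : ℝ) (h : Pt d → ℂ) (t : Pt d) : ℂ :=
  ∫ y, planeWave c t y * h y

theorem integrable_planeWave_mul {c : ℝ} {h : Pt d → ℂ} {ν : Measure (Pt d)} (hh : Integrable h ν)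
    (t : Pt d) : Integrable (fun y => planeWave c t y * h y) ν := by
  refine hh.bdd_mul (c := 1) ?_ (Eventually.of_forall fun y => (norm_planeWave c t y).le)
  exact ((continuous_planeWave c).comp (by fun_prop : Continuous fun y : Pt d =>
    (t, y))).aestronglyMeasurable

theorem norm_waveIntegral_le (c : ℝ) (h : Pt d → ℂ) (t : Pt d) :
    ‖waveIntegral c h t‖ ≤ ∫ y, ‖h y‖ := by
  refine (norm_integral_le_integral_norm _).trans_eq ?_
  simp [norm_planeWave]

theorem continuous_waveIntegral (c : ℝ) {h : Pt d → ℂ} (hh : Integrable h) :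
    Continuous (waveIntegral c h) := by
  refine continuous_of_dominated (bound := fun y => ‖h y‖)
    (fun t => (integrable_planeWave_mul hh t).aestronglyMeasurable)
    (fun t => Eventually.of_forall fun y => by simp [norm_planeWave]) hh.norm
    (Eventually.of_forall fun y => ?_)
  exact ((continuous_planeWave c).comp (by fun_prop : Continuous fun t : Pt d => (t, y))).mul
    continuous_const

/-- An integrable function whose Fourier integral vanishes identically is zero. -/
theorem ae_eq_zero_of_waveIntegral_eq_zero {c : ℝ} (hc : c ≠ 0) {h : Pt d → ℂ} (hh : Integrable h)
    (h0 : ∀ t, waveIntegral c h t = 0) : ∀ᵐ y, h y = 0 := by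
  refine ae_eq_zero_of_integral_contDiff_smul_eq_zero hh.locallyIntegrable fun g hg hgs => ?_
  have hs : HasCompactSupport fun y => (g y : ℂ) := hgs.comp_left (g := fun r : ℝ => (r : ℂ)) rfl
  have hd : ContDiff ℝ ((⊤ : ℕ∞) : WithTop ℕ∞) fun y => (g y : ℂ) :=
    Complex.ofRealCLM.contDiff.comp hg
  let φ : SchwartzMap (Pt d) ℂ := hs.toSchwartzMap hd
  -- Each test function is a Fourier transform, `g = ψ̂`; moving the transform onto `h` gives `∫ g h
  -- = ∫ ψ ĥ = 0`.
  let ψ : SchwartzMap (Pt d) ℂ := FourierTransformInv.fourierInv φ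
  have hψ : FourierTransform.fourier ψ = φ := FourierTransform.fourier_fourierInv_eq φ
  have key := VectorFourier.integral_fourierIntegral_smul_eq_flip (L := innerₗ (Pt d))
    (μ := volume) (ν := volume) (f := ψ) (g := h)
    Real.continuous_fourierChar continuous_inner ψ.integrable hh
  have hL : ∀ ξ, VectorFourier.fourierIntegral Real.fourierChar volume (innerₗ (Pt d)) ψ ξ =
      (g ξ : ℂ) := by
    intro ξ
    have := congrArg (fun F : SchwartzMap (Pt d) ℂ => F ξ) hψ
    simpa [SchwartzMap.fourier_coe, Real.fourier_eq, VectorFourier.fourierIntegral, φ] using! this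
  have hR : ∀ x, VectorFourier.fourierIntegral Real.fourierChar volume (innerₗ (Pt d)).flip h x =
      0 := by
    intro x
    -- This rescaling converts the kernel `e^{-2πi x·y}` into `e^{ic t·y}`.
    rw [← h0 ((-(2 * Real.pi) / c) • x)]
    refine integral_congr_ae (Eventually.of_forall fun y => ?_)
    simp only [LinearMap.flip_apply, innerₗ_apply_apply, Circle.smul_def, smul_eq_mul,
      Real.fourierChar_apply, planeWave, inner_smul_left]
    congr 2
    rw [real_inner_comm]
    simp
    have : (c : ℂ) ≠ 0 := by exact_mod_cast hc
    field_simp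
  simp only [hL, hR, smul_zero, integral_zero] at key
  simpa using key

/-- Identity theorem for Fourier integrals of functions supported in the unit ball. -/
theorem waveIntegral_eq_zero_of_ae_eq_zero_on_open (c : ℝ) {h : Pt d → ℂ} (hh : Integrable h)
    (hsupp : ∀ᵐ y, y ∉ unitBall d → h y = 0) {U : Set (Pt d)} (hU : IsOpen U) (hne : U.Nonempty)
    (h0 : ∀ᵐ t ∂(volume.restrict U), waveIntegral c h t = 0) (t : Pt d) :
    waveIntegral c h t = 0 := by
  have hU0 : EqOn (waveIntegral c h) 0 U :=
    Measure.eqOn_open_of_ae_eq h0 hU (continuous_waveIntegral c hh).continuousOn continuousOn_const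
  obtain ⟨t₀, ht₀⟩ := hne
  set v := t - t₀ with hv
  -- The line `t₀ + z v` with complex `z` passes through `t₀` at `z = 0` and `t` at `z = 1`. Support
  -- in the unit ball gives `|v·y| ≤ ‖v‖`, which controls the exponential growth.
  let F : ℂ → Pt d → ℂ := fun z y =>
    Complex.exp (Complex.I * (c * ((inner ℝ t₀ y : ℝ) + z * (inner ℝ v y : ℝ)))) * h y
  let F' : ℂ → Pt d → ℂ := fun z y =>
    (Complex.exp (Complex.I * (c * ((inner ℝ t₀ y : ℝ) + z * (inner ℝ v y : ℝ)))) *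
      (Complex.I * (c * (inner ℝ v y : ℝ)))) * h y
  have hnorm : ∀ᵐ y, ∀ z, ‖F z y‖ ≤ Real.exp (‖z‖ * (|c| * ‖v‖)) * ‖h y‖ := by
    filter_upwards [hsupp] with y hy z
    by_cases hyB : y ∈ unitBall d
    · simp only [F]
      rw [norm_mul]
      refine mul_le_mul_of_nonneg_right ?_ (norm_nonneg _)
      rw [Complex.norm_exp]
      refine Real.exp_le_exp.2 ?_
      have h1 : ‖y‖ ≤ 1 := by
        have : y ∈ Metric.ball (0 : Pt d) 1 := hyB
        exact (mem_ball_zero_iff.1 this).le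
      have h2 : |(inner ℝ v y : ℝ)| ≤ ‖v‖ :=
        (abs_real_inner_le_norm v y).trans (mul_le_of_le_one_right (norm_nonneg _) h1)
      have h3 : |z.im| ≤ ‖z‖ := Complex.abs_im_le_norm z
      have h4 : (Complex.I * (c * ((inner ℝ t₀ y : ℝ) + z * (inner ℝ v y : ℝ)))).re =
          -(z.im * (c * inner ℝ v y)) := by
        simp
        ring
      rw [h4]
      refine (neg_le_abs _).trans ?_
      rw [abs_mul, abs_mul]
      gcongr
    · simp [F, hy hyB]
  have hmeas : ∀ z, AEStronglyMeasurable (F z) volume := fun z =>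
    AEStronglyMeasurable.mul (Continuous.aestronglyMeasurable (by fun_prop)) hh.1
  have hmeas' : ∀ z, AEStronglyMeasurable (F' z) volume := fun z =>
    AEStronglyMeasurable.mul (Continuous.aestronglyMeasurable (by fun_prop)) hh.1
  have hderiv : ∀ z, DifferentiableAt ℂ (fun z => ∫ y, F z y) z := by
    intro z
    refine (hasDerivAt_integral_of_dominated_loc_of_deriv_le (F := F) (F' := F')
      (bound := fun y => (|c| * ‖v‖) * (Real.exp ((‖z‖ + 1) * (|c| * ‖v‖)) * ‖h y‖))
      (Metric.ball_mem_nhds z one_pos) (Eventually.of_forall hmeas) ?_ (hmeas' z)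
      ?_ ?_ ?_).2.differentiableAt
    · refine (hh.norm.const_mul (Real.exp (‖z‖ * (|c| * ‖v‖)))).mono' (hmeas z) ?_
      filter_upwards [hnorm] with y hy using hy z
    · filter_upwards [hnorm, hsupp] with y hy hs w hw
      by_cases hyB : y ∈ unitBall d
      · have h1 : ‖y‖ ≤ 1 := by
          have : y ∈ Metric.ball (0 : Pt d) 1 := hyB
          exact (mem_ball_zero_iff.1 this).le
        have h2 : |(inner ℝ v y : ℝ)| ≤ ‖v‖ :=
          (abs_real_inner_le_norm v y).trans (mul_le_of_le_one_right (norm_nonneg _) h1)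
        have h3 : F' w y = (Complex.I * (c * (inner ℝ v y : ℝ))) * F w y := by
          simp only [F, F']; ring
        rw [h3, norm_mul]
        have h4 : ‖Complex.I * (c * ((inner ℝ v y : ℝ) : ℂ))‖ ≤ |c| * ‖v‖ := by
          rw [norm_mul, norm_mul, Complex.norm_I, one_mul, Complex.norm_real, Complex.norm_real]
          simp only [Real.norm_eq_abs]
          gcongr
        have h5 : ‖w‖ ≤ ‖z‖ + 1 := by
          have h6 : ‖w - z‖ < 1 := mem_ball_iff_norm.1 hw
          have h7 := norm_sub_norm_le w z
          linarith
        refine mul_le_mul h4 ((hy w).trans ?_) (norm_nonneg _) (by positivity)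
        gcongr
      · simp [F', hs hyB]
    · exact (hh.norm.const_mul _).const_mul _
    · refine Eventually.of_forall fun y w _ => ?_
      refine HasDerivAt.mul_const ?_ (h y)
      refine HasDerivAt.cexp ?_
      refine HasDerivAt.const_mul _ (HasDerivAt.const_mul _ ?_)
      simpa using ((hasDerivAt_id w).mul_const ((inner ℝ v y : ℝ) : ℂ)).const_add
        ((inner ℝ t₀ y : ℝ) : ℂ)
  have hF : ∀ r : ℝ, ∫ y, F r y = waveIntegral c h (t₀ + r • v) := by
    intro r
    refine integral_congr_ae (Eventually.of_forall fun y => ?_)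
    simp only [F, planeWave, inner_add_left, inner_smul_left]
    push_cast
    rfl
  have han : AnalyticOnNhd ℂ (fun z => ∫ y, F z y) univ :=
    DifferentiableOn.analyticOnNhd (fun z _ => (hderiv z).differentiableWithinAt) isOpen_univ
  -- Small real `z` keep the point inside `U`, so the zeros accumulate at 0 and the entire function
  -- vanishes identically.
  have hfreq : ∃ᶠ z in 𝓝[≠] (0 : ℂ), (fun z => ∫ y, F z y) z = (0 : ℂ → ℂ) z := by
    have hcont : Tendsto (fun r : ℝ => t₀ + r • v) (𝓝[≠] 0) (𝓝 t₀) := by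
      have : Continuous fun r : ℝ => t₀ + r • v := by fun_prop
      simpa using (this.tendsto 0).mono_left nhdsWithin_le_nhds
    have hev : ∀ᶠ r : ℝ in 𝓝[≠] 0, ∫ y, F r y = 0 := by
      filter_upwards [hcont (hU.mem_nhds ht₀)] with r hr
      rw [hF]
      exact hU0 hr
    have htend : Tendsto (fun r : ℝ => (r : ℂ)) (𝓝[≠] 0) (𝓝[≠] 0) := by
      refine tendsto_nhdsWithin_of_tendsto_nhds_of_eventually_within _ ?_ ?_
      · exact (Complex.continuous_ofReal.tendsto 0).mono_left nhdsWithin_le_nhds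
      · filter_upwards [self_mem_nhdsWithin] with r hr
        simpa using hr
    exact htend.frequently hev.frequently
  have h1 := congrFun (han.eq_of_frequently_eq analyticOnNhd_const hfreq) 1
  have h2 := hF 1
  simp only [Complex.ofReal_one] at h2
  have h3 : t₀ + (1 : ℝ) • v = t := by simp [hv]
  rw [← h3, ← h2]
  exact h1

theorem ae_eq_zero_of_waveIntegral_ae_eq_zero_on_open {c : ℝ} (hc : c ≠ 0) {h : Pt d → ℂ}
    (hh : Integrable h) (hsupp : ∀ᵐ y, y ∉ unitBall d → h y = 0) {U : Set (Pt d)} (hU : IsOpen U)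
    (hne : U.Nonempty) (h0 : ∀ᵐ t ∂(volume.restrict U), waveIntegral c h t = 0) :
    ∀ᵐ y, h y = 0 :=
  ae_eq_zero_of_waveIntegral_eq_zero hc hh
    (waveIntegral_eq_zero_of_ae_eq_zero_on_open c hh hsupp hU hne h0)

end FourierLSM

/-! ### The operator `S` and its adjoint on `L²(B)` -/

namespace FourierLSM

variable {d : ℕ}

instance isFiniteMeasure_restrict_unitBall :
    IsFiniteMeasure ((volume : Measure (Pt d)).restrict (unitBall d)) :=
  isFiniteMeasure_restrict.2 measure_ball_lt_top.ne

/-- The plane wave `s ↦ e^{i c s·y}` as an element of `L²(B)`. -/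
noncomputable def waveVec (c : ℝ) (y : Pt d) : L2B d :=
  MemLp.toLp (fun s => planeWave c s y)
    (MemLp.of_bound (Continuous.aestronglyMeasurable
      ((continuous_planeWave c).comp (by fun_prop : Continuous fun s : Pt d => (s, y)))) 1
      (Eventually.of_forall fun s => (norm_planeWave c s y).le))

theorem coeFn_waveVec (c : ℝ) (y : Pt d) :
    waveVec c y =ᵐ[volume.restrict (unitBall d)] fun s => planeWave c s y :=
  MemLp.coeFn_toLp _

/-- Riesz representation of the point evaluations of `S g`: continuity and boundedness of `S g` come
from those of `waveVec`, and `S^* Q S` becomes an integral of rank one operators. -/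
theorem opS_eq_inner (c : ℝ) (g : L2B d) (y : Pt d) : opS c g y = inner ℂ (waveVec c y) g := by
  rw [L2.inner_def, opS]
  refine integral_congr_ae ?_
  filter_upwards [coeFn_waveVec c y] with s hs
  rw [hs, RCLike.inner_apply, conj_planeWave, mul_comm]

/-- The phase is Lipschitz in `y`, uniformly for `s` in the unit ball, and the ball has finite
measure. -/
theorem continuous_waveVec (c : ℝ) : Continuous (waveVec c : Pt d → L2B d) := by
  set K : ℝ := (volume.restrict (unitBall d)).real univ ^ (ENNReal.toReal 2)⁻¹ with hK
  have hK0 : 0 ≤ K := by positivity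
  refine (LipschitzWith.of_dist_le_mul (K := Real.toNNReal (K * |c|)) fun y y' => ?_).continuous
  rw [dist_eq_norm, dist_eq_norm, Real.coe_toNNReal _ (by positivity), mul_assoc]
  refine Lp.norm_le_of_ae_bound (by positivity) ?_
  filter_upwards [Lp.coeFn_sub (waveVec c y) (waveVec c y'), coeFn_waveVec c y, coeFn_waveVec c y',
    ae_restrict_mem Metric.isOpen_ball.measurableSet] with s h1 h2 h3 h4
  rw [h1, Pi.sub_apply, h2, h3]
  refine (norm_planeWave_sub_le c s y y').trans ?_
  have h5 : ‖s‖ ≤ 1 := (mem_ball_zero_iff.1 h4).le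
  gcongr
  exact mul_le_of_le_one_right (abs_nonneg _) h5

theorem exists_norm_waveVec_le (c : ℝ) (d : ℕ) : ∃ K : ℝ, ∀ y : Pt d, ‖waveVec c y‖ ≤ K := by
  refine ⟨(volume.restrict (unitBall d)).real univ ^ (ENNReal.toReal 2)⁻¹ * 1, fun y => ?_⟩
  refine Lp.norm_le_of_ae_bound zero_le_one ?_
  filter_upwards [coeFn_waveVec c y] with s hs
  rw [hs, norm_planeWave]

theorem continuous_opS (c : ℝ) (g : L2B d) : Continuous (opS c g) := by
  have : opS c g = fun y => inner ℂ (waveVec c y) g := funext (opS_eq_inner c g)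
  rw [this]
  exact (continuous_waveVec c).inner continuous_const

theorem exists_norm_opS_le (c : ℝ) (g : L2B d) : ∃ K : ℝ, ∀ y, ‖opS c g y‖ ≤ K := by
  obtain ⟨K, hK⟩ := exists_norm_waveVec_le c d
  refine ⟨K * ‖g‖, fun y => ?_⟩
  rw [opS_eq_inner]
  exact (norm_inner_le_norm _ _).trans (mul_le_mul_of_nonneg_right (hK y) (norm_nonneg _))

theorem integrable_coeFn_L2B (g : L2B d) : Integrable g (volume.restrict (unitBall d)) :=
  (Lp.memLp g).integrable (by norm_num)

theorem integrable_mul_opS (c : ℝ) (g : L2B d) {h : Pt d → ℂ} {ν : Measure (Pt d)}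
    (hh : Integrable h ν) : Integrable (fun y => h y * opS c g y) ν := by
  obtain ⟨K, hK⟩ := exists_norm_opS_le c g
  exact hh.mul_bdd (c := K) (continuous_opS c g).aestronglyMeasurable (Eventually.of_forall hK)

theorem opS_eq_waveIntegral (c : ℝ) (g : Pt d → ℂ) (y : Pt d) :
    opS c g y = waveIntegral (-c) ((unitBall d).indicator g) y := by
  rw [opS, waveIntegral, ← integral_indicator
    (show MeasurableSet (unitBall d) from Metric.isOpen_ball.measurableSet)]
  refine integral_congr_ae (Eventually.of_forall fun s => ?_)
  by_cases hs : s ∈ unitBall d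
  · simp only [Set.indicator_of_mem hs, planeWave_comm]
  · simp only [Set.indicator_of_notMem hs, mul_zero]

/-- If `S g` vanishes almost everywhere on a nonempty open set, then `g = 0`. -/
theorem eq_zero_of_opS_ae_eq_zero {c : ℝ} (hc : c ≠ 0) {g : L2B d} {U : Set (Pt d)} (hU : IsOpen U)
    (hne : U.Nonempty) (h0 : ∀ᵐ y ∂(volume.restrict U), opS c g y = 0) : g = 0 := by
  have h1 := ae_eq_zero_of_waveIntegral_ae_eq_zero_on_open (neg_ne_zero.2 hc)
    (IntegrableOn.integrable_indicator (integrable_coeFn_L2B g)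
      (show MeasurableSet (unitBall d) from Metric.isOpen_ball.measurableSet))
    (Eventually.of_forall fun y hy => Set.indicator_of_notMem hy _) hU hne
    (h0.mono fun y hy => by rw [← opS_eq_waveIntegral, hy])
  rw [Lp.eq_zero_iff_ae_eq_zero, Filter.EventuallyEq,
    ae_restrict_iff' (show MeasurableSet (unitBall d) from Metric.isOpen_ball.measurableSet)]
  filter_upwards [h1] with y hy hyB
  rwa [Set.indicator_of_mem hyB] at hy

theorem memLp_waveIntegral (c : ℝ) {h : Pt d → ℂ} (hh : Integrable h) :
    MemLp (waveIntegral c h) 2 (volume.restrict (unitBall d)) :=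
  MemLp.of_bound (continuous_waveIntegral c hh).aestronglyMeasurable _
    (Eventually.of_forall (norm_waveIntegral_le c h))

/-- The Fourier integral of an integrable function as an element of `L²(B)`. -/
noncomputable def waveL2 (c : ℝ) {h : Pt d → ℂ} (hh : Integrable h) : L2B d :=
  (memLp_waveIntegral c hh).toLp _

theorem coeFn_waveL2 (c : ℝ) {h : Pt d → ℂ} (hh : Integrable h) :
    waveL2 c hh =ᵐ[volume.restrict (unitBall d)] waveIntegral c h :=
  MemLp.coeFn_toLp _

theorem waveL2_congr (c : ℝ) {h h' : Pt d → ℂ} (hh : Integrable h) (hh' : Integrable h')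
    (e : h =ᵐ[volume] h') : waveL2 c hh = waveL2 c hh' := by
  have : waveIntegral c h = waveIntegral c h' := by
    funext t
    refine integral_congr_ae ?_
    filter_upwards [e] with y hy
    rw [hy]
  simp only [waveL2, this]

/-- The identity theorem applied on `B` itself. This injectivity of `S^*` yields totality of the
weighted system. -/
theorem ae_eq_zero_of_waveL2_eq_zero {c : ℝ} (hc : c ≠ 0) {h : Pt d → ℂ} (hh : Integrable h)
    (hsupp : ∀ᵐ y, y ∉ unitBall d → h y = 0) (h0 : waveL2 c hh = 0) : ∀ᵐ y, h y = 0 := by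
  refine ae_eq_zero_of_waveIntegral_ae_eq_zero_on_open hc hh hsupp Metric.isOpen_ball
    ⟨(0 : Pt d), Metric.mem_ball_self one_pos⟩ ?_
  have h1 := coeFn_waveL2 c hh
  rw [h0] at h1
  filter_upwards [h1, Lp.coeFn_zero ℂ 2 (volume.restrict (unitBall d))] with t ht ht'
  rw [← ht, ht']
  rfl

/-- The Fourier integral is adjoint to `S`. -/
theorem inner_waveL2 (c : ℝ) (g : L2B d) {h : Pt d → ℂ} (hh : Integrable h) :
    inner ℂ g (waveL2 c hh) = ∫ y, h y * (starRingEnd ℂ) (opS c g y) := by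
  have hg := integrable_coeFn_L2B g
  have hgc : Integrable (fun t => (starRingEnd ℂ) ((g : Pt d → ℂ) t))
      (volume.restrict (unitBall d)) :=
    (RCLike.conjCLE (K := ℂ)).toContinuousLinearMap.integrable_comp hg
  calc inner ℂ g (waveL2 c hh)
      = ∫ t in unitBall d, ∫ y, planeWave c t y * ((starRingEnd ℂ) ((g : Pt d → ℂ) t) * h y) := by
        rw [L2.inner_def]
        refine integral_congr_ae ?_
        filter_upwards [coeFn_waveL2 c hh] with t ht
        rw [ht, RCLike.inner_apply, waveIntegral, ← integral_mul_const]
        exact integral_congr_ae (Eventually.of_forall fun y => by simp only []; ring)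
    _ = ∫ y, ∫ t in unitBall d, planeWave c t y * ((starRingEnd ℂ) ((g : Pt d → ℂ) t) * h y) := by
        refine integral_integral_swap ?_
        exact (hgc.mul_prod hh).bdd_mul (c := 1) (continuous_planeWave c).aestronglyMeasurable
          (Eventually.of_forall fun p => (norm_planeWave c p.1 p.2).le)
    _ = ∫ y, h y * (starRingEnd ℂ) (opS c g y) := by
        refine integral_congr_ae (Eventually.of_forall fun y => ?_)
        simp only [opS]
        rw [← integral_conj, ← integral_const_mul]
        refine integral_congr_ae (Eventually.of_forall fun t => ?_)
        simp only [map_mul, conj_planeWave, neg_neg]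
        ring

/-! ### The weighted operator `S^* Q S` -/

/-- `Q` is a bounded weight supported in `D` and bounded below there by `m`. -/
structure IsWeight (D : Set (Pt d)) (m : ℝ) (Q : Pt d → ℝ) : Prop where
  pos : 0 < m
  aestronglyMeasurable : AEStronglyMeasurable Q volume
  bdd : ∃ M, ∀ᵐ y, |Q y| ≤ M
  support : ∀ y, y ∉ D → Q y = 0
  lower : ∀ᵐ y, y ∈ D → m ≤ Q y

section Weight

variable {D : Set (Pt d)} {m : ℝ} {Q : Pt d → ℝ}

theorem IsWeight.integrable (hQ : IsWeight D m Q) (hDB : D ⊆ unitBall d) :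
    Integrable (fun y => (Q y : ℂ)) := by
  obtain ⟨M, hM⟩ := hQ.bdd
  have h1 : Integrable Q := by
    have h2 : IntegrableOn Q D := by
      refine IntegrableOn.of_bound
        ((measure_mono hDB).trans_lt (measure_ball_lt_top (x := (0 : Pt d)) (r := 1)))
        hQ.aestronglyMeasurable.restrict M ?_
      exact ae_restrict_of_ae hM
    refine (integrableOn_iff_integrable_of_support_subset ?_).1 h2
    intro y hy
    by_contra h
    exact hy (hQ.support y h)
  exact h1.ofReal

/-- The operator `g ↦ S^* (Q · S g)` is a compact operator on `L²(B)`. -/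
theorem exists_isCompactOperator_eq_waveL2 (c : ℝ) (hQ : Integrable (fun y => (Q y : ℂ))) :
    ∃ T : L2B d →L[ℂ] L2B d, IsCompactOperator T ∧
      ∀ g, T g = waveL2 c (integrable_mul_opS c g hQ) := by
  obtain ⟨K, hK⟩ := exists_norm_waveVec_le c d
  obtain ⟨T, hT, hTi⟩ := exists_isCompactOperator_inner_eq_integral (continuous_waveVec c) hK hQ
  refine ⟨T, hT, fun g => ext_inner_left ℂ fun h => ?_⟩
  rw [inner_waveL2, hTi]
  refine integral_congr_ae (Eventually.of_forall fun y => ?_)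
  simp only [opS_eq_inner, inner_conj_symm]

/-- The quadratic form from which positivity is read off. -/
theorem inner_waveL2_mul_opS (c : ℝ) (hQ : Integrable (fun y => (Q y : ℂ))) (g : L2B d) :
    inner ℂ g (waveL2 c (integrable_mul_opS c g hQ)) =
      ((∫ y, Q y * ‖opS c g y‖ ^ 2 : ℝ) : ℂ) := by
  rw [inner_waveL2, ← integral_complex_ofReal]
  refine integral_congr_ae (Eventually.of_forall fun y => ?_)
  simp only []
  rw [mul_assoc, Complex.mul_conj, Complex.normSq_eq_norm_sq]
  push_cast
  rfl

/-- Indicators of infinitely many disjoint nonempty open subsets of `B` are nonzero and orthogonal.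
For `d = 0` the ball is a single point. -/
theorem not_finiteDimensional_L2B (hd : d ≠ 0) : ¬ FiniteDimensional ℂ (L2B d) := by
  have : NeZero d := ⟨hd⟩
  have hinf : Infinite (unitBall d) :=
    (infinite_of_mem_nhds (0 : Pt d) (Metric.ball_mem_nhds 0 one_pos)).to_subtype
  obtain ⟨U, hUi, hUo, hUd⟩ := exists_seq_infinite_isOpen_pairwise_disjoint (unitBall d)
  let V : ℕ → Set (Pt d) := fun n => Subtype.val '' U n
  have hBo : IsOpen (unitBall d) := Metric.isOpen_ball
  have hVo : ∀ n, IsOpen (V n) := fun n => hBo.isOpenMap_subtype_val _ (hUo n)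
  have hVB : ∀ n, V n ⊆ unitBall d := fun n => Subtype.coe_image_subset _ _
  have hVd : Pairwise (Function.onFun Disjoint V) := fun i j hij =>
    (disjoint_image_iff Subtype.val_injective).2 (hUd hij)
  have hpos : ∀ n, (volume.restrict (unitBall d)) (V n) ≠ 0 := fun n => by
    rw [Measure.restrict_apply (hVo n).measurableSet, inter_eq_left.2 (hVB n)]
    exact ((hVo n).measure_pos volume ((hUi n).nonempty.image _)).ne'
  let v : ℕ → L2B d := fun n => indicatorConstLp 2 (hVo n).measurableSet (measure_ne_top _ _) 1
  have hv0 : ∀ n, v n ≠ 0 := fun n h => by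
    have h1 := norm_indicatorConstLp (p := 2) (c := (1 : ℂ)) (hs := (hVo n).measurableSet)
      (hμs := measure_ne_top (volume.restrict (unitBall d)) _) (by norm_num) (by norm_num)
    rw [show indicatorConstLp 2 _ _ (1 : ℂ) = v n from rfl, h, norm_zero, norm_one, one_mul] at h1
    have h2 : 0 < (volume.restrict (unitBall d)).real (V n) :=
      ENNReal.toReal_pos (hpos n) (measure_ne_top _ _)
    exact (Real.rpow_pos_of_pos h2 _).ne h1
  have hvo : Pairwise fun i j => inner ℂ (v i) (v j) = 0 := fun i j hij => by
    refine (L2.inner_indicatorConstLp_eq_inner_setIntegral ℂ _ _ _ _).trans ?_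
    have h1 : ∫ x in V i, (v j : Pt d → ℂ) x ∂(volume.restrict (unitBall d)) = 0 := by
      refine setIntegral_eq_zero_of_ae_eq_zero ?_
      filter_upwards [indicatorConstLp_coeFn (p := 2) (c := (1 : ℂ)) (hs := (hVo j).measurableSet)
        (hμs := measure_ne_top (volume.restrict (unitBall d)) _)] with x hx hxi
      rw [hx, Set.indicator_of_notMem]
      exact fun hxj => Set.disjoint_left.1 (hVd hij) hxi hxj
    rw [h1, inner_zero_right]
  intro hfd
  exact (linearIndependent_of_ne_zero_of_inner_eq_zero hv0 hvo).finite.false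

/-- Existence of the eigensystem of `g ↦ S^* (Q · S g)`. -/
theorem IsWeight.exists_eigensystem (hd : d ≠ 0) {c : ℝ} (hc : c ≠ 0) (hQ : IsWeight D m Q)
    (hD : IsOpen D) (hDB : D ⊆ unitBall d) (hne : D.Nonempty) :
    ∃ (ζ : HilbertBasis ℕ ℂ (L2B d)) (μ : ℕ → ℝ), Antitone μ ∧ (∀ n, 0 < μ n) ∧
      ∀ n, waveL2 c (integrable_mul_opS c (ζ n) (hQ.integrable hDB)) = (μ n : ℂ) • ζ n := by
  obtain ⟨T, hT, hTg⟩ := exists_isCompactOperator_eq_waveL2 c (hQ.integrable hDB)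
  have hsymm : T.IsSymmetric := by
    intro g h
    change inner ℂ (T g) h = inner ℂ g (T h)
    rw [← inner_conj_symm, hTg, hTg, inner_waveL2, inner_waveL2, ← integral_conj]
    refine integral_congr_ae (Eventually.of_forall fun y => ?_)
    simp only [map_mul, Complex.conj_ofReal, Complex.conj_conj]
    ring
  have hpos : ∀ g, g ≠ 0 → 0 < (inner ℂ g (T g)).re := by
    intro g hg
    rw [hTg, inner_waveL2_mul_opS c (hQ.integrable hDB), Complex.ofReal_re]
    have hnn : 0 ≤ᵐ[volume] fun y => Q y * ‖opS c g y‖ ^ 2 := by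
      filter_upwards [hQ.lower] with y hy
      by_cases hyD : y ∈ D
      · exact mul_nonneg (hQ.pos.le.trans (hy hyD)) (sq_nonneg _)
      · simp [hQ.support y hyD]
    have hint : Integrable fun y => Q y * ‖opS c g y‖ ^ 2 := by
      obtain ⟨K, hK⟩ := exists_norm_opS_le c g
      refine (hQ.integrable hDB).re.mul_bdd (c := K ^ 2)
        ((continuous_opS c g).norm.pow 2).aestronglyMeasurable (Eventually.of_forall fun y => ?_)
      rw [norm_pow, norm_norm]
      gcongr
      exact hK y
    -- If the form vanishes, then `S g = 0` a.e. on `D`, since `Q > 0` there; hence `g = 0`.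
    refine lt_of_le_of_ne (integral_nonneg_of_ae hnn) fun h => hg ?_
    have h1 := (integral_eq_zero_iff_of_nonneg_ae hnn hint).1 h.symm
    refine eq_zero_of_opS_ae_eq_zero hc hD hne ?_
    rw [ae_restrict_iff' hD.measurableSet]
    filter_upwards [h1, hQ.lower] with y h2 h3 hyD
    have h4 : 0 < Q y := hQ.pos.trans_le (h3 hyD)
    have h5 : Q y * ‖opS c g y‖ ^ 2 = 0 := h2
    simpa [h4.ne'] using h5
  obtain ⟨ζ, μ, h1, h2, h3⟩ := exists_hilbertBasis_antitone_eigenvalues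
    (not_finiteDimensional_L2B hd) hT hsymm hpos
  exact ⟨ζ, μ, h1, h2, fun n => by rw [← hTg, h3]⟩

/-- Parseval's identity in the weighted space on `D` along an eigensystem. -/
theorem IsWeight.hasSum_norm_inner_sq_div {c : ℝ} (hc : c ≠ 0) (hQ : IsWeight D m Q)
    (hD : IsOpen D) (hDB : D ⊆ unitBall d) (ζ : HilbertBasis ℕ ℂ (L2B d)) {μ : ℕ → ℝ}
    (hμ : ∀ n, 0 < μ n)
    (hζ : ∀ n, waveL2 c (integrable_mul_opS c (ζ n) (hQ.integrable hDB)) = (μ n : ℂ) • ζ n)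
    {E : Pt d → ℂ} (hE : Integrable E) (hED : ∀ y, y ∉ D → E y = 0)
    (hEb : ∃ C, ∀ y, ‖E y‖ ≤ C) :
    HasSum (fun n => ‖inner ℂ (ζ n) (waveL2 c hE)‖ ^ 2 / μ n) (∫ y in D, ‖E y‖ ^ 2 / Q y) := by
  have hfin : IsFiniteMeasure ((volume : Measure (Pt d)).restrict D) := isFiniteMeasure_restrict.2
    ((measure_mono hDB).trans_lt (measure_ball_lt_top (x := (0 : Pt d)) (r := 1))).ne
  obtain ⟨M, hM⟩ := hQ.bdd
  have hsm : AEStronglyMeasurable (fun y => ((√(Q y) : ℝ) : ℂ)) volume :=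
    (Complex.continuous_ofReal.comp Real.continuous_sqrt).comp_aestronglyMeasurable
      hQ.aestronglyMeasurable
  have hsb : ∀ᵐ y, ‖((√(Q y) : ℝ) : ℂ)‖ ≤ √M := by
    filter_upwards [hM] with y hy
    rw [Complex.norm_real, Real.norm_eq_abs, abs_of_nonneg (Real.sqrt_nonneg _)]
    exact Real.sqrt_le_sqrt ((le_abs_self _).trans hy)
  -- The map `g ↦ √Q · S g` into `L²(D)` has adjoint `v ↦ S^* (√Q v)`, and their composition is `S^*
  -- Q S`.
  have hχm : ∀ g : L2B d,
      MemLp (fun y => ((√(Q y) : ℝ) : ℂ) * opS c g y) 2 (volume.restrict D) := by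
    intro g
    obtain ⟨K, hK⟩ := exists_norm_opS_le c g
    refine MemLp.of_bound (hsm.restrict.mul (continuous_opS c g).aestronglyMeasurable) (√M * K) ?_
    filter_upwards [ae_restrict_of_ae hsb] with y hy
    rw [norm_mul]
    exact mul_le_mul hy (hK y) (norm_nonneg _) (Real.sqrt_nonneg _)
  have hvi : ∀ v : Lp ℂ 2 ((volume : Measure (Pt d)).restrict D),
      Integrable (D.indicator fun y => ((√(Q y) : ℝ) : ℂ) * (v : Pt d → ℂ) y) := by
    intro v
    refine IntegrableOn.integrable_indicator ?_ hD.measurableSet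
    exact ((Lp.memLp v).integrable (by norm_num)).bdd_mul hsm.restrict (ae_restrict_of_ae hsb)
  have hinner : ∀ (g : L2B d) (v : Lp ℂ 2 ((volume : Measure (Pt d)).restrict D)),
      inner ℂ ((hχm g).toLp _) v = inner ℂ g (waveL2 c (hvi v)) := by
    intro g v
    rw [inner_waveL2, L2.inner_def]
    have h1 : ∀ y, (D.indicator fun y => ((√(Q y) : ℝ) : ℂ) * (v : Pt d → ℂ) y) y *
        (starRingEnd ℂ) (opS c g y) =
        D.indicator (fun y => ((√(Q y) : ℝ) : ℂ) * (v : Pt d → ℂ) y *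
          (starRingEnd ℂ) (opS c g y)) y := fun y => by
      by_cases hy : y ∈ D
      · rw [Set.indicator_of_mem hy, Set.indicator_of_mem hy]
      · rw [Set.indicator_of_notMem hy, Set.indicator_of_notMem hy, zero_mul]
    simp_rw [h1]
    rw [integral_indicator hD.measurableSet]
    refine integral_congr_ae ?_
    filter_upwards [(hχm g).coeFn_toLp] with y hy
    rw [hy, RCLike.inner_apply, map_mul, Complex.conj_ofReal]
    ring
  have hself : ∀ g : L2B d, waveL2 c (hvi ((hχm g).toLp _)) =
      waveL2 c (integrable_mul_opS c g (hQ.integrable hDB)) := by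
    intro g
    refine waveL2_congr c _ _ ?_
    have h1 := (hχm g).coeFn_toLp
    rw [Filter.EventuallyEq, ae_restrict_iff' hD.measurableSet] at h1
    filter_upwards [h1, hQ.lower] with y hy hl
    by_cases hyD : y ∈ D
    · rw [Set.indicator_of_mem hyD, hy hyD, ← mul_assoc, ← Complex.ofReal_mul,
        Real.mul_self_sqrt (hQ.pos.le.trans (hl hyD))]
    · rw [Set.indicator_of_notMem hyD, hQ.support y hyD, Complex.ofReal_zero, zero_mul]
  have horth : ∀ i j, inner ℂ ((hχm (ζ i)).toLp _) ((hχm (ζ j)).toLp _) =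
      if i = j then (μ j : ℂ) else 0 := by
    intro i j
    rw [hinner, hself, hζ, inner_smul_right, orthonormal_iff_ite.1 ζ.orthonormal i j]
    split_ifs <;> simp
  have htotal : ∀ v : Lp ℂ 2 ((volume : Measure (Pt d)).restrict D),
      (∀ n, inner ℂ ((hχm (ζ n)).toLp _) v = 0) → v = 0 := by
    intro v hv
    have h1 : waveL2 c (hvi v) = 0 := by
      rw [← LinearIsometryEquiv.map_eq_zero_iff ζ.repr]
      ext n
      rw [HilbertBasis.repr_apply_apply, ← hinner, hv n]
      rfl
    have h2 := ae_eq_zero_of_waveL2_eq_zero hc (hvi v)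
      (Eventually.of_forall fun y hy => Set.indicator_of_notMem (fun h => hy (hDB h)) _) h1
    rw [Lp.eq_zero_iff_ae_eq_zero, Filter.EventuallyEq, ae_restrict_iff' hD.measurableSet]
    filter_upwards [h2, hQ.lower] with y hy hl hyD
    rw [Set.indicator_of_mem hyD] at hy
    have h3 : √(Q y) ≠ 0 := (Real.sqrt_pos.2 (hQ.pos.trans_le (hl hyD))).ne'
    simpa [h3] using hy
  obtain ⟨C, hC⟩ := hEb
  -- Parseval is applied to `w = E/√Q`, chosen so that `S^* (√Q w) = S^* E`; the bound `Q ≥ m` puts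
  -- it in `L²(D)`.
  have hwm : MemLp (fun y => ((√(Q y) : ℝ) : ℂ)⁻¹ * E y) 2 (volume.restrict D) := by
    refine MemLp.of_bound (hsm.restrict.aemeasurable.inv.aestronglyMeasurable.mul hE.1.restrict)
      ((√m)⁻¹ * C) ?_
    filter_upwards [(ae_restrict_iff' hD.measurableSet).2 hQ.lower] with y hy
    have h1 : 0 < √m := Real.sqrt_pos.2 hQ.pos
    have h2 : √m ≤ √(Q y) := Real.sqrt_le_sqrt hy
    rw [norm_mul, norm_inv, Complex.norm_real, Real.norm_eq_abs, abs_of_nonneg (Real.sqrt_nonneg _)]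
    exact mul_le_mul (inv_anti₀ h1 h2) (hC y) (norm_nonneg _) (by positivity)
  have hwE : waveL2 c (hvi (hwm.toLp _)) = waveL2 c hE := by
    refine waveL2_congr c _ _ ?_
    have h1 := hwm.coeFn_toLp
    rw [Filter.EventuallyEq, ae_restrict_iff' hD.measurableSet] at h1
    filter_upwards [h1, hQ.lower] with y hy hl
    by_cases hyD : y ∈ D
    · have h3 : √(Q y) ≠ 0 := (Real.sqrt_pos.2 (hQ.pos.trans_le (hl hyD))).ne'
      have h4 : ((√(Q y) : ℝ) : ℂ) ≠ 0 := by exact_mod_cast h3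
      rw [Set.indicator_of_mem hyD, hy hyD, mul_inv_cancel_left₀ h4]
    · rw [Set.indicator_of_notMem hyD, hED y hyD]
  have key := hasSum_norm_inner_sq_div_of_orthogonal hμ horth htotal (hwm.toLp _)
  simp only [hinner, hwE] at key
  convert key using 1
  have h5 : ((‖hwm.toLp _‖ ^ 2 : ℝ) : ℂ) = ((∫ y in D, ‖E y‖ ^ 2 / Q y : ℝ) : ℂ) := by
    have h6 := inner_self_eq_norm_sq_to_K (𝕜 := ℂ) (hwm.toLp _)
    rw [L2.inner_def] at h6
    push_cast
    refine h6.symm.trans ?_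
    rw [← integral_complex_ofReal]
    refine integral_congr_ae ?_
    filter_upwards [hwm.coeFn_toLp, (ae_restrict_iff' hD.measurableSet).2 hQ.lower] with y hy hl
    have h7 : ∀ x : ℂ, inner ℂ x x = ((‖x‖ ^ 2 : ℝ) : ℂ) := fun x => by
      rw [inner_self_eq_norm_sq_to_K]; push_cast; rfl
    rw [hy, h7, norm_mul, norm_inv, Complex.norm_real, Real.norm_eq_abs,
      abs_of_nonneg (Real.sqrt_nonneg _), mul_pow, inv_pow, Real.sq_sqrt (hQ.pos.le.trans hl),
      div_eq_inv_mul]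
  exact_mod_cast h5.symm

end Weight

end FourierLSM

/-! ### Factorization of the data operator and the test functions -/

namespace FourierLSM

variable {d : ℕ}

theorem exists_ae_abs_le_of_memLp_top {q : Pt d → ℝ} (hq : MemLp q ⊤ volume) :
    ∃ C : ℝ, ∀ᵐ y, |q y| ≤ C := by
  have h1 : eLpNormEssSup q volume ≠ ⊤ := by
    have := hq.2
    rw [eLpNorm_exponent_top] at this
    exact this.ne
  refine ⟨(eLpNormEssSup q volume).toReal, ?_⟩
  filter_upwards [ae_le_eLpNormEssSup (f := q) (μ := volume)] with y hy
  have h2 := ENNReal.toReal_mono h1 hy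
  rwa [toReal_enorm, Real.norm_eq_abs] at h2

theorem isWeight_qTilde {Ω D : Set (Pt d)} (hΩ : IsOpen Ω) (hD : IsOpen D) (hΩD : Ω ⊆ D)
    {q : Pt d → ℝ} (hq : MemLp q ⊤ volume) {qinf m : ℝ} (hm : 0 < m)
    (hpos : ∀ᵐ x, x ∈ D → m ≤ qTilde qinf D Ω q x) : IsWeight D m (qTilde qinf D Ω q) where
  pos := hm
  aestronglyMeasurable := (aestronglyMeasurable_const.indicator hD.measurableSet).add
    (hq.1.indicator hΩ.measurableSet)
  bdd := by
    obtain ⟨C, hC⟩ := exists_ae_abs_le_of_memLp_top hq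
    refine ⟨|qinf| + C, ?_⟩
    filter_upwards [hC] with y hy
    refine (abs_add_le _ _).trans (add_le_add ?_ ?_)
    · by_cases h : y ∈ D <;> simp [h]
    · by_cases h : y ∈ Ω
      · simpa [h] using hy
      · simpa [h] using (abs_nonneg _).trans hy
  support y hy := by
    have h1 : y ∉ Ω := fun h => hy (hΩD h)
    simp [qTilde, hy, h1]
  lower := hpos

/-- Separation of `t` and `s` in the kernel, the source of the factorization. -/
theorem planeWave_two_mul_half_sub (c : ℝ) (t s y : Pt d) :
    planeWave (2 * c) ((2⁻¹ : ℝ) • (t - s)) y = planeWave c t y * planeWave (-c) s y := by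
  simp only [planeWave]
  rw [← Complex.exp_add, inner_smul_left, inner_sub_left]
  congr 1
  simp
  ring

/-- The data operator factorizes as `S^* q S`. -/
theorem dataOp_eq_setIntegral (c : ℝ) {q : Pt d → ℝ} (hq : IntegrableOn q (unitBall d))
    (g : L2B d) (t : Pt d) :
    dataOp c q g t = ∫ y in unitBall d, planeWave c t y * ((q y : ℂ) * opS c g y) := by
  have hg := integrable_coeFn_L2B g
  have hqc : Integrable (fun y => (q y : ℂ)) (volume.restrict (unitBall d)) := hq.ofReal
  calc dataOp c q g t
      = ∫ s in unitBall d, ∫ y in unitBall d,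
          (planeWave c t y * planeWave (-c) s y) * ((g : Pt d → ℂ) s * (q y : ℂ)) := by
        refine integral_congr_ae (Eventually.of_forall fun s => ?_)
        simp only [dataFn, planeWave_two_mul_half_sub]
        rw [← integral_mul_const]
        exact integral_congr_ae (Eventually.of_forall fun y => by simp only []; ring)
    _ = ∫ y in unitBall d, ∫ s in unitBall d,
          (planeWave c t y * planeWave (-c) s y) * ((g : Pt d → ℂ) s * (q y : ℂ)) := by
        refine integral_integral_swap ?_
        refine (hg.mul_prod hqc).bdd_mul (c := 1) (Continuous.aestronglyMeasurable ?_)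
          (Eventually.of_forall fun p => by rw [norm_mul, norm_planeWave, norm_planeWave, one_mul])
        exact ((continuous_planeWave c).comp
          (by fun_prop : Continuous fun p : Pt d × Pt d => (t, p.2))).mul (continuous_planeWave (-c))
    _ = ∫ y in unitBall d, planeWave c t y * ((q y : ℂ) * opS c g y) := by
        refine integral_congr_ae (Eventually.of_forall fun y => ?_)
        simp only [opS]
        rw [← integral_const_mul, ← integral_const_mul]
        exact integral_congr_ae (Eventually.of_forall fun s => by simp only []; ring)

/-- The modified data operator factorizes as `S^* q̃ S`. -/
theorem dataOpTilde_eq_waveIntegral (c : ℝ) {Ω D : Set (Pt d)} (hD : IsOpen D)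
    (hΩD : Ω ⊆ D) (hDB : D ⊆ unitBall d) {q : Pt d → ℝ} (hq : MemLp q ⊤ volume)
    (hqsupp : ∀ᵐ x, x ∉ Ω → q x = 0) (qinf : ℝ) (g : L2B d) (t : Pt d) :
    dataOpTilde c qinf D q g t =
      waveIntegral c (fun y => (qTilde qinf D Ω q y : ℂ) * opS c g y) t := by
  have hB : MeasurableSet (unitBall d) := Metric.isOpen_ball.measurableSet
  have hqB : IntegrableOn q (unitBall d) := by
    obtain ⟨C, hC⟩ := exists_ae_abs_le_of_memLp_top hq
    exact IntegrableOn.of_bound measure_ball_lt_top hq.1.restrict C (ae_restrict_of_ae hC)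
  have h1 : Integrable ((unitBall d).indicator fun y =>
      planeWave c t y * ((q y : ℂ) * opS c g y)) :=
    IntegrableOn.integrable_indicator
      (integrable_planeWave_mul (integrable_mul_opS c g hqB.ofReal) t) hB
  have h2 : Integrable (D.indicator fun y => (opS c g y * (qinf : ℂ)) * planeWave c t y) := by
    refine IntegrableOn.integrable_indicator ?_ hD.measurableSet
    have hfin : IsFiniteMeasure ((volume : Measure (Pt d)).restrict D) := isFiniteMeasure_restrict.2
      ((measure_mono hDB).trans_lt (measure_ball_lt_top (x := (0 : Pt d)) (r := 1))).ne
    refine (integrable_planeWave_mul (c := c)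
      (integrable_mul_opS c g (integrable_const (qinf : ℂ))) t).congr
        (Eventually.of_forall fun y => ?_)
    simp only []
    ring
  rw [dataOpTilde, dataOp_eq_setIntegral c hqB, dataOpInf, ← integral_indicator hB,
    ← integral_indicator hD.measurableSet, ← integral_add h2 h1, waveIntegral]
  refine integral_congr_ae ?_
  filter_upwards [hqsupp] with y hy
  simp only [qTilde]
  by_cases hyΩ : y ∈ Ω
  · have hyD := hΩD hyΩ
    simp only [Set.indicator_of_mem hyΩ, Set.indicator_of_mem hyD, Set.indicator_of_mem (hDB hyD)]
    push_cast
    ring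
  · have h3 := hy hyΩ
    by_cases hyD : y ∈ D
    · simp only [Set.indicator_of_notMem hyΩ, Set.indicator_of_mem hyD,
        Set.indicator_of_mem (hDB hyD), h3]
      push_cast
      ring
    · by_cases hyB : y ∈ unitBall d
      · simp [hyΩ, hyD, hyB, h3]
      · simp [hyΩ, hyD, hyB]

/-- The eigenvalue equations as identities in `L²(B)`. -/
theorem dataOpTilde_ae_eq_iff (c : ℝ) {Ω D : Set (Pt d)} (hD : IsOpen D)
    (hΩD : Ω ⊆ D) (hDB : D ⊆ unitBall d) {q : Pt d → ℝ} (hq : MemLp q ⊤ volume)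
    (hqsupp : ∀ᵐ x, x ∉ Ω → q x = 0) {qinf : ℝ}
    (hQ : Integrable (fun y => (qTilde qinf D Ω q y : ℂ))) (g : L2B d) (l : ℂ) :
    dataOpTilde c qinf D q g =ᵐ[volume.restrict (unitBall d)] (fun t => l * (g : Pt d → ℂ) t) ↔
      waveL2 c (integrable_mul_opS c g hQ) = l • g := by
  have h1 : dataOpTilde c qinf D q g =
      waveIntegral c (fun y => (qTilde qinf D Ω q y : ℂ) * opS c g y) :=
    funext (dataOpTilde_eq_waveIntegral c hD hΩD hDB hq hqsupp qinf g)
  have h2 := coeFn_waveL2 c (integrable_mul_opS c g hQ)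
  have h3 := Lp.coeFn_smul l g
  rw [h1]
  constructor
  · exact fun h => Lp.ext (h2.trans (h.trans h3.symm))
  · intro h
    rw [h] at h2
    exact h2.symm.trans h3

theorem integrable_avgFn {A : Set (Pt d)} (hA : MeasurableSet A) (hAB : A ⊆ unitBall d) :
    Integrable (avgFn A) := by
  have h1 : IntegrableOn (fun _ => (1 : ℂ)) A :=
    integrableOn_const ((measure_mono hAB).trans_lt
      (measure_ball_lt_top (x := (0 : Pt d)) (r := 1))).ne
  exact (h1.integrable_indicator hA).const_mul _

theorem conj_charFn (A : Set (Pt d)) (y : Pt d) : (starRingEnd ℂ) (charFn A y) = charFn A y := by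
  by_cases h : y ∈ A <;> simp [charFn, h]

theorem conj_avgFn (A : Set (Pt d)) (y : Pt d) : (starRingEnd ℂ) (avgFn A y) = avgFn A y := by
  rw [avgFn, map_mul, conj_charFn, map_inv₀, Complex.conj_ofReal]

/-- Testing `S g` against `1_A` amounts to testing `g` against the test function of `A`. -/
theorem l2Inner_opS_charFn (c : ℝ) {A : Set (Pt d)} (hA : MeasurableSet A)
    (hAB : A ⊆ unitBall d) (hA0 : (volume : Measure (Pt d)).real A ≠ 0) (g : L2B d) :
    l2Inner (unitBall d) (opS c g) (charFn A) =
      ((volume : Measure (Pt d)).real A : ℂ) *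
        inner ℂ (waveL2 c (integrable_avgFn hA hAB)) g := by
  rw [← inner_conj_symm, inner_waveL2, ← integral_conj, ← integral_const_mul, l2Inner,
    ← integral_indicator (show MeasurableSet (unitBall d) from Metric.isOpen_ball.measurableSet)]
  refine integral_congr_ae (Eventually.of_forall fun y => ?_)
  have h1 : ((volume : Measure (Pt d)).real A : ℂ) ≠ 0 := by exact_mod_cast hA0
  simp only [map_mul, Complex.conj_conj, conj_avgFn]
  rw [avgFn, ← mul_assoc, mul_inv_cancel_left₀ h1]
  by_cases hy : y ∈ unitBall d
  · rw [Set.indicator_of_mem hy, conj_charFn, mul_comm]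
  · rw [Set.indicator_of_notMem hy, charFn, Set.indicator_of_notMem fun h => hy (hAB h), zero_mul]

/-- The test function is `S^*` of the normalized indicator. `l2Inner` conjugates its second argument
and `inner` its first, hence the swap. -/
theorem l2Inner_phiFn (c : ℝ) {A : Set (Pt d)} (hA : MeasurableSet A) (hAB : A ⊆ unitBall d)
    (g : L2B d) : l2Inner (unitBall d) (phiFn c A) g =
      inner ℂ g (waveL2 c (integrable_avgFn hA hAB)) := by
  rw [L2.inner_def, l2Inner]
  refine integral_congr_ae ?_
  filter_upwards [coeFn_waveL2 c (integrable_avgFn hA hAB)] with t ht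
  rw [ht, RCLike.inner_apply]
  rfl

/-- On `A` one has `|A| E² = E`, and `E` vanishes off `A`. -/
theorem setIntegral_norm_avgFn_sq_div {A D : Set (Pt d)} (hA : MeasurableSet A)
    (hD : MeasurableSet D) (hAD : A ⊆ D)
    (hA0 : (volume : Measure (Pt d)).real A ≠ 0) (Q : Pt d → ℝ) :
    ((volume : Measure (Pt d)).real A : ℂ) * ((∫ y in D, ‖avgFn A y‖ ^ 2 / Q y : ℝ) : ℂ) =
      l2Inner A (fun y => ((1 / Q y : ℝ) : ℂ)) (avgFn A) := by
  have h1 : ∫ y in D, ‖avgFn A y‖ ^ 2 / Q y = ∫ y in A, ‖avgFn A y‖ ^ 2 / Q y := by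
    refine setIntegral_eq_of_subset_of_forall_sdiff_eq_zero hD hAD fun y hy => ?_
    simp [avgFn, charFn, hy.2]
  rw [h1, ← integral_complex_ofReal, ← integral_const_mul, l2Inner]
  refine setIntegral_congr_fun hA fun y hy => ?_
  have h2 : ((volume : Measure (Pt d)).real A : ℂ) ≠ 0 := by exact_mod_cast hA0
  simp only [conj_avgFn]
  simp only [avgFn, charFn, Set.indicator_of_mem hy, mul_one, norm_inv, Complex.norm_real,
    Real.norm_eq_abs, inv_pow, sq_abs]
  push_cast
  field_simp

end FourierLSM

/-! ### The main theorem -/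

theorem mainTheorem5
    (d : ℕ) (hd : d = 1 ∨ d = 2) (c : ℝ) (hc : 0 < c)
    (Ω D : Set (FourierLSM.Pt d)) (hΩ : IsOpen Ω) (hD : IsOpen D)
    (hΩD : Ω ⊆ D) (hDB : D ⊆ FourierLSM.unitBall d)
    (q : FourierLSM.Pt d → ℝ) (hq : MemLp q ⊤ volume)
    (hqsupp : ∀ᵐ x ∂(volume : Measure (FourierLSM.Pt d)), x ∉ Ω → q x = 0)
    (qinf : ℝ) (hqinf : 0 < qinf)
    (m : ℝ) (hm : 0 < m)
    (hpos : ∀ᵐ x ∂(volume : Measure (FourierLSM.Pt d)),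
      x ∈ D → m ≤ FourierLSM.qTilde qinf D Ω q x)
    (R : FourierLSM.Pt d → ℝ → Set (FourierLSM.Pt d)) (Rinf Rsup : ℝ) (hRinf : 0 < Rinf)
    (hRmeas : ∀ z ε, 0 < ε → MeasurableSet (R z ε))
    (hRvol : ∀ z ε, 0 < ε →
      Rinf * ε ^ d ≤ (volume : Measure (FourierLSM.Pt d)).real (R z ε) ∧
      (volume : Measure (FourierLSM.Pt d)).real (R z ε) ≤ Rsup * ε ^ d)
    (z : FourierLSM.Pt d) (ε : ℝ) (hε : 0 < ε) (hRD : closure (R z ε) ⊆ D) :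
    (∃ (ζ : HilbertBasis ℕ ℂ (FourierLSM.L2B d)) (μ : ℕ → ℝ),
      FourierLSM.IsEigensystem (FourierLSM.dataOpTilde c qinf D q) ζ μ) ∧
    (∀ (ζ : HilbertBasis ℕ ℂ (FourierLSM.L2B d)) (μ : ℕ → ℝ),
      FourierLSM.IsEigensystem (FourierLSM.dataOpTilde c qinf D q) ζ μ →
      ∀ (f : ℝ → ℝ → ℝ) (d₀ : ℝ), FourierLSM.IsRegularizingFilter f d₀ →
        Tendsto
          (fun α : ℝ =>
            FourierLSM.l2Inner (FourierLSM.unitBall d)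
              (FourierLSM.opS c
                (FourierLSM.regSolution ζ μ f α (FourierLSM.phiFn c (R z ε))))
              (FourierLSM.charFn (R z ε)))
          (𝓝[>] 0)
          (𝓝 (FourierLSM.l2Inner (R z ε)
            (fun y => ((1 / FourierLSM.qTilde qinf D Ω q y : ℝ) : ℂ))
            (FourierLSM.avgFn (R z ε))))) ∧
    FourierLSM.l2Inner (R z ε)
        (fun y => ((1 / FourierLSM.qTilde qinf D Ω q y : ℝ) : ℂ))
        (FourierLSM.avgFn (R z ε)) =
      FourierLSM.l2Inner (R z ε)
        (fun y => (((1 / qinf) / (1 + q y / qinf) : ℝ) : ℂ))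
        (FourierLSM.avgFn (R z ε)) := by
  have hd0 : d ≠ 0 := by rcases hd with rfl | rfl <;> norm_num
  have hA := hRmeas z ε hε
  have hAD : R z ε ⊆ D := subset_closure.trans hRD
  have hAB : R z ε ⊆ FourierLSM.unitBall d := hAD.trans hDB
  have hA0 : 0 < (volume : Measure (FourierLSM.Pt d)).real (R z ε) :=
    (mul_pos hRinf (pow_pos hε d)).trans_le (hRvol z ε hε).1
  -- The lower volume bound gives `R z ε` positive measure, so `D` is nonempty, as injectivity of
  -- `S` on `D` requires.
  have hne : D.Nonempty := by
    refine (nonempty_of_measure_ne_zero (μ := volume) fun h => hA0.ne' ?_).mono hAD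
    rw [measureReal_def, h, ENNReal.toReal_zero]
  have hQ := FourierLSM.isWeight_qTilde hΩ hD hΩD hq hm hpos
  have hiff := FourierLSM.dataOpTilde_ae_eq_iff c hD hΩD hDB hq hqsupp (hQ.integrable hDB)
  refine ⟨?_, ?_, ?_⟩
  · obtain ⟨ζ, μ, h1, h2, h3⟩ := hQ.exists_eigensystem hd0 hc.ne' hD hDB hne
    exact ⟨ζ, μ, h1, h2, fun n => (hiff (ζ n) (μ n)).2 (h3 n)⟩
  · intro ζ μ hζ f d₀ hf
    obtain ⟨h1, h2, h3⟩ := hζ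
    have hS := hQ.hasSum_norm_inner_sq_div hc.ne' hD hDB ζ h2
      (fun n => (hiff (ζ n) (μ n)).1 (h3 n)) (FourierLSM.integrable_avgFn hA hAB)
      (fun y hy => by
        rw [FourierLSM.avgFn, FourierLSM.charFn, Set.indicator_of_notMem fun h => hy (hAD h),
          mul_zero])
      ⟨((volume : Measure (FourierLSM.Pt d)).real (R z ε))⁻¹, fun y => by
        by_cases hy : y ∈ R z ε
        · simp [FourierLSM.avgFn, FourierLSM.charFn, hy, abs_of_pos hA0]
        · simp [FourierLSM.avgFn, FourierLSM.charFn, hy]⟩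
    have hlim := (FourierLSM.tendsto_inner_filtered_expansion ζ h1 h2 hf _ hS).const_mul
      ((volume : Measure (FourierLSM.Pt d)).real (R z ε) : ℂ)
    rw [FourierLSM.setIntegral_norm_avgFn_sq_div hA hD.measurableSet hAD hA0.ne'] at hlim
    simp only [FourierLSM.l2Inner_opS_charFn c hA hAB hA0.ne', FourierLSM.regSolution,
      FourierLSM.l2Inner_phiFn c hA hAB]
    exact hlim
  · refine integral_congr_ae ?_
    filter_upwards [ae_restrict_of_ae hqsupp, ae_restrict_mem hA] with y hy hyA
    have h1 : FourierLSM.qTilde qinf D Ω q y = qinf + q y := by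
      by_cases hyΩ : y ∈ Ω
      · simp [FourierLSM.qTilde, hAD hyA, hyΩ]
      · simp [FourierLSM.qTilde, hAD hyA, hyΩ, hy hyΩ]
    have h2 : (1 / qinf) / (1 + q y / qinf) = 1 / (qinf + q y) := by
      rw [div_div, mul_add, mul_one, mul_div_cancel₀ _ hqinf.ne']
    rw [h1, h2]
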